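/- Let $\Omega\subset\mathbb{R}^N$ be a bounded convex domain (open set), let $\varepsilon>0$, and let $\mu$ be a Borel probability measure on $\Omega\times\{0,1\}$ such that the class-conditional distributions $\varrho_i:=\mu(\,\cdot\,\times\{i\})$, $i\in\{0,1\}$, are absolutely continuous with respect to the Lebesgue measure; denote their densities again by $\varrho_0,\varrho_1$. Write $B_\varepsilon(x)$ for the open Euclidean ball, $\overline{B_\varepsilon(x)}$ for its closure, and for $u\in L^\infty(\Omega)$ put $$\operatorname{TV}_\varepsilon(u):=\int_\Omega\frac{\operatorname{ess\,sup}_{B_\varepsilon(x)\cap\Omega}u-u(x)}{\varepsilon}\,\varrho_0(x)\,dx+\int_\Omega\frac{u(x)-\operatorname{ess\,inf}_{B_\varepsilon(x)\cap\Omega}u}{\varepsilon}\,\varrho_1(x)\,dx,$$ with essential suprema and infima taken with respect to the Lebesgue measure. Let $\mathfrak{P}$ be the set of all $\Psi\in L^1(\Omega\times\Omega)$ with $\Psi\ge 0$ a.e. on $\Omega\times\Omega$ and, for a.e. $x\in\Omega$, $\int_\Omega\Psi(x,y)\,dy=1$ and $\operatorname{ess\,supp}\Psi(x,\cdot)\subset\overline{B_\varepsilon(x)}\cap\overline\Omega$.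 For $\boldsymbol\Psi=(\Psi_0,\Psi_1)\in\mathfrak{P}\times\mathfrak{P}$ and $x,y\in\Omega$ define $$[\boldsymbol\Psi;\boldsymbol\varrho](x,y):=\Psi_0(x,y)\varrho_0(x)-\Psi_1(x,y)\varrho_1(x),\qquad \nabla_\varepsilon[u](x,y):=\frac{u(y)-u(x)}{\varepsilon},$$ and, for $f\in L^1(\Omega\times\Omega)$, $$\operatorname{div}_\varepsilon[f](y):=\int_{B_\varepsilon(y)\cap\Omega}\frac{f(y,x)-f(x,y)}{\varepsilon}\,dx .$$ Then for every $u\in L^\infty(\Omega)$ both integrals defining $\operatorname{TV}_\varepsilon(u)$ are finite; for every $\boldsymbol\Psi\in\mathfrak{P}\times\mathfrak{P}$ the functions $[\boldsymbol\Psi;\boldsymbol\varrho]$ and $\nabla_\varepsilon[u]\,[\boldsymbol\Psi;\boldsymbol\varrho]$ belong to $L^1(\Omega\times\Omega)$, and $\operatorname{div}_\varepsilon[\boldsymbol\Psi;\boldsymbol\varrho]:=\operatorname{div}_\varepsilon\big[[\boldsymbol\Psi;\boldsymbol\varrho]\big]$ and $u\operatorname{div}_\varepsilon[\boldsymbol\Psi;\boldsymbol\varrho]$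 belong to $L^1(\Omega)$; and $$\operatorname{TV}_\varepsilon(u)=\sup_{\boldsymbol\Psi\in\mathfrak{P}\times\mathfrak{P}}\int_\Omega\int_\Omega\nabla_\varepsilon[u](x,y)\,[\boldsymbol\Psi;\boldsymbol\varrho](x,y)\,dy\,dx=\sup_{\boldsymbol\Psi\in\mathfrak{P}\times\mathfrak{P}}-\int_\Omega u(y)\operatorname{div}_\varepsilon[\boldsymbol\Psi;\boldsymbol\varrho](y)\,dy .$$ -/

import Mathlib

open MeasureTheory Set Metric
open scoped ENNReal Topology

-- Subsets carry the restricted measure: for `Ω` open, `volume` on the subtype `Ω` is Lebesgue measure.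
attribute [local instance] MeasureTheory.Measure.Subtype.measureSpace

noncomputable section

namespace AdversarialTV

/-- The class-conditional distribution `A ↦ μ (A × {i})` of a measure `μ` on `Ω × {0,1}`. -/
def classMeasure {X : Type*} [MeasurableSpace X] (μ : Measure (X × Fin 2)) (i : Fin 2) :
    Measure X :=
  (μ.restrict (univ ×ˢ {i})).map Prod.fst

variable {N : ℕ} {Ω : Set (EuclideanSpace ℝ (Fin N))}

/-- The Lebesgue density of the `i`-th class-conditional distribution. The measure `volume` on the
subtype `Ω` is the restriction of the `N`-dimensional Lebesgue measure to `Ω`. -/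
def density (μ : Measure (Ω × Fin 2)) (i : Fin 2) (x : Ω) : ℝ :=
  ((classMeasure μ i).rnDeriv volume x).toReal

/-- The essential support, as a (closed) subset of `ℝᴺ`, of a function on `Ω`: the points that
have no neighbourhood on which the function vanishes almost everywhere. -/
def essSupport (φ : Ω → ℝ) : Set (EuclideanSpace ℝ (Fin N)) :=
  {z | ∀ U ∈ 𝓝 z, ¬ ∀ᵐ y : Ω, (y : EuclideanSpace ℝ (Fin N)) ∈ U → φ y = 0}

/-- The test functions: transition densities in `L¹(Ω × Ω)` whose essential support in the second
variable lies in the closed `ε`-ball around the first one. Since elements of `L¹` are classes of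
functions, conditions on the slices `Ψ (x, ·)` are required for almost every `x`. -/
def testDensities (Ω : Set (EuclideanSpace ℝ (Fin N))) (ε : ℝ) :
    Set (Lp ℝ 1 (volume : Measure (Ω × Ω))) :=
  {Ψ | (∀ᵐ p : Ω × Ω, 0 ≤ Ψ p) ∧
    (∀ᵐ x : Ω, ∫ y : Ω, Ψ (x, y) = 1) ∧
    ∀ᵐ x : Ω, essSupport (fun y : Ω => Ψ (x, y)) ⊆
      closedBall (x : EuclideanSpace ℝ (Fin N)) ε ∩ closure Ω}

/-- The nonlocal gradient `(x, y) ↦ (u y - u x) / ε`. -/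
def nonlocalGrad (ε : ℝ) (u : Ω → ℝ) (p : Ω × Ω) : ℝ :=
  (u p.2 - u p.1) / ε

/-- The nonlocal divergence; `ball y ε` is the ball of the metric space `Ω`, i.e. the Euclidean
ball intersected with `Ω`. -/
def nonlocalDiv (ε : ℝ) (f : Ω × Ω → ℝ) (y : Ω) : ℝ :=
  ∫ x in ball y ε, (f (y, x) - f (x, y)) / ε

/-- The antisymmetric pairing `[Ψ; ρ] (x, y) = Ψ₀ (x, y) ρ₀ x - Ψ₁ (x, y) ρ₁ x`. -/
def pairing (Ψ₀ Ψ₁ : Ω × Ω → ℝ) (ρ₀ ρ₁ : Ω → ℝ) (p : Ω × Ω) : ℝ :=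
  Ψ₀ p * ρ₀ p.1 - Ψ₁ p * ρ₁ p.1

/-- The integrand of the first term of the adversarial total variation. -/
def upperIntegrand (ε : ℝ) (ρ₀ u : Ω → ℝ) (x : Ω) : ℝ :=
  (essSup u (volume.restrict (ball x ε)) - u x) / ε * ρ₀ x

/-- The integrand of the second term of the adversarial total variation. -/
def lowerIntegrand (ε : ℝ) (ρ₁ u : Ω → ℝ) (x : Ω) : ℝ :=
  (u x - essInf u (volume.restrict (ball x ε))) / ε * ρ₁ x

/-- The adversarial total variation. -/
def adversarialTV (ε : ℝ) (ρ₀ ρ₁ u : Ω → ℝ) : ℝ :=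
  (∫ x : Ω, upperIntegrand ε ρ₀ u x) + ∫ x : Ω, lowerIntegrand ε ρ₁ u x

end AdversarialTV

end

set_option linter.unusedSectionVars false

/-! For a.e. `x` the slice `Ψ₀ (x, ·)` is a probability density living on the ball around `x`, so
averaging `u y - u x` against it gives at most the essential supremum over the ball minus `u x`.
Multiplying by `ρ₀ ≥ 0` and integrating bounds the first term of the total variation. The `Ψ₁` term
is the same statement for `-u`, so the two terms can be treated separately.

The bound is approached by the uniform density on those `y` in the ball where `u` comes within `δ`
of its essential supremum: this set has positive measure, and the loss is at most `δ / ε` times the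
mass of `ρ`. That this density is jointly measurable rests on the lower semicontinuity of the
essential supremum over `ball x ε` in `x`.

The second representation is Fubini plus the swap of variables: the pairing vanishes a.e. at
distance at least `ε`, so restricting the divergence to the ball loses nothing. Closed and open
balls are interchangeable because spheres are null. -/

namespace AdversarialTV

/-! ### Real-valued essential suprema of a.e. bounded functions. -/

section EssSup

variable {X : Type*} [MeasurableSpace X] {ν : Measure X} {u : X → ℝ} {M : ℝ}

theorem isBoundedUnder_le_of_ae_abs_le (hu : ∀ᵐ x ∂ν, |u x| ≤ M) :
    Filter.IsBoundedUnder (· ≤ ·) (ae ν) u :=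
  ⟨M, by
    rw [Filter.eventually_map]
    filter_upwards [hu] with x hx using (le_abs_self _).trans hx⟩

theorem ae_le_essSup_of_ae_abs_le (hu : ∀ᵐ x ∂ν, |u x| ≤ M) : ∀ᵐ x ∂ν, u x ≤ essSup u ν :=
  ae_le_essSup (isBoundedUnder_le_of_ae_abs_le hu)

theorem essSup_le_of_ae_abs_le [NeZero ν] (hu : ∀ᵐ x ∂ν, |u x| ≤ M) {c : ℝ}
    (hc : ∀ᵐ x ∂ν, u x ≤ c) : essSup u ν ≤ c := by
  have : (ae ν).NeBot := ae_neBot.2 (NeZero.ne ν)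
  have hbelow : Filter.IsBoundedUnder (· ≥ ·) (ae ν) u :=
    ⟨-M, by
      rw [Filter.eventually_map]
      filter_upwards [hu] with x hx using (abs_le.1 hx).1⟩
  exact Filter.limsup_le_of_le hbelow.isCoboundedUnder_le hc

theorem abs_essSup_le [NeZero ν] (hu : ∀ᵐ x ∂ν, |u x| ≤ M) : |essSup u ν| ≤ M := by
  have : (ae ν).NeBot := ae_neBot.2 (NeZero.ne ν)
  refine abs_le.2 ⟨?_, essSup_le_of_ae_abs_le hu ?_⟩
  · obtain ⟨x, hx, hx'⟩ := (hu.and (ae_le_essSup_of_ae_abs_le hu)).exists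
    exact (abs_le.1 hx).1.trans hx'
  · filter_upwards [hu] with x hx using (le_abs_self _).trans hx

theorem measure_lt_pos_of_lt_essSup [NeZero ν] (hu : ∀ᵐ x ∂ν, |u x| ≤ M) {c : ℝ}
    (hc : c < essSup u ν) : 0 < ν {x | c < u x} := by
  rw [pos_iff_ne_zero]
  intro h
  refine hc.not_ge (essSup_le_of_ae_abs_le hu ?_)
  rw [ae_iff]
  simpa only [not_le] using h

/-- Boundedness plays no role: `sInf` on `ℝ` is by definition a reflected `sSup`, so default values
agree as well. -/
theorem essInf_eq_neg_essSup_neg (u : X → ℝ) (ν : Measure X) :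
    essInf u ν = -essSup (fun x => -u x) ν := by
  rw [essInf, essSup, Filter.liminf_eq, Filter.limsup_eq, Real.sInf_def, neg_neg]
  congr 1
  ext a
  simp

end EssSup

/-! ### Essential suprema over balls, and averages against transition densities. -/

section MetricMeasure

variable {X : Type*} [MetricSpace X] [MeasureSpace X] [BorelSpace X]

theorem neZero_restrict_ball [(volume : Measure X).IsOpenPosMeasure] {ε : ℝ} (hε : 0 < ε) (x : X) :
    NeZero ((volume : Measure X).restrict (ball x ε)) :=
  ⟨fun h => (measure_ball_pos volume x hε).ne' (Measure.restrict_eq_zero.1 h)⟩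

/-- An open ball is a countable union of balls of smaller radius, which cannot all meet `A` in null
sets. -/
theorem exists_lt_measure_inter_ball_pos {A : Set X} {x : X} {ε : ℝ}
    (h : 0 < volume (A ∩ ball x ε)) : ∃ r < ε, 0 < volume (A ∩ ball x r) := by
  by_contra! hcon
  have hU : A ∩ ball x ε ⊆ ⋃ n : ℕ, A ∩ ball x (ε - 1 / (n + 1)) := by
    rintro y ⟨hyA, hy⟩
    obtain ⟨n, hn⟩ := exists_nat_one_div_lt (sub_pos.2 (mem_ball.1 hy))
    exact mem_iUnion.2 ⟨n, hyA, mem_ball.2 (by linarith)⟩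
  refine h.ne' (measure_mono_null hU (measure_iUnion_null fun n => ?_))
  exact nonpos_iff_eq_zero.1 (hcon _ (sub_lt_self _ (by positivity)))

variable {ε M : ℝ} {u : X → ℝ}

/-- If `u > c'` on a set of positive measure in `ball x ε`, then already on one in `ball x r` with
`r < ε`; that set stays inside `ball z ε` for all `z` within `ε - r` of `x`. -/
theorem lowerSemicontinuous_essSup_ball [(volume : Measure X).IsOpenPosMeasure] (hε : 0 < ε)
    (hum : Measurable u) (hu : ∀ᵐ x, |u x| ≤ M) :
    LowerSemicontinuous fun x => essSup u (volume.restrict (ball x ε)) := by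
  intro x c hc
  obtain ⟨c', hcc', hc'⟩ := exists_between hc
  have := neZero_restrict_ball hε x
  have hpos := measure_lt_pos_of_lt_essSup (ae_restrict_of_ae hu) hc'
  rw [Measure.restrict_apply (measurableSet_lt measurable_const hum)] at hpos
  obtain ⟨r, hr, hpos⟩ := exists_lt_measure_inter_ball_pos hpos
  filter_upwards [ball_mem_nhds x (sub_pos.2 hr)] with z hz
  refine hcc'.trans_le ?_
  by_contra! hlt
  refine hpos.ne' (measure_mono_null ?_ (ae_iff.1
    ((ae_restrict_iff' measurableSet_ball).1 (ae_le_essSup_of_ae_abs_le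
      (ae_restrict_of_ae (s := ball z ε) hu)))))
  rintro y ⟨hy, hyx⟩
  have hyz : y ∈ ball z ε := by
    have h1 := dist_triangle y x z
    rw [mem_ball] at *
    rw [dist_comm x z] at h1
    linarith
  simp only [mem_ofPred_eq, Classical.not_imp, not_le] at hy ⊢
  exact ⟨hyz, hlt.trans hy⟩

variable [SecondCountableTopology X] [IsFiniteMeasure (volume : Measure X)]

theorem integrable_essSup_sub_div_mul [(volume : Measure X).IsOpenPosMeasure] (hε : 0 < ε)
    (hum : Measurable u) (hu : ∀ᵐ x, |u x| ≤ M) {ρ : X → ℝ} (hρ : Integrable ρ) :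
    Integrable fun x => (essSup u (volume.restrict (ball x ε)) - u x) / ε * ρ x := by
  refine hρ.bdd_mul (c := (M + M) / ε) ?_ ?_
  · exact (((lowerSemicontinuous_essSup_ball hε hum hu).measurable.sub hum).div_const
      ε).aestronglyMeasurable
  · filter_upwards [hu] with x hx
    have := neZero_restrict_ball hε x
    rw [Real.norm_eq_abs, abs_div, abs_of_pos hε]
    gcongr
    exact (abs_sub _ _).trans
      (add_le_add (abs_essSup_le (ae_restrict_of_ae hu)) hx)

/-- A measurable representative of a probability transition density with jumps of length less
than `ε`. -/
structure IsTransitionDensity (ε : ℝ) (Ψ : X × X → ℝ) : Prop where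
  measurable : Measurable Ψ
  nonneg : ∀ᵐ p, 0 ≤ Ψ p
  integral_eq_one : ∀ᵐ x, ∫ y, Ψ (x, y) = 1
  eq_zero : ∀ᵐ p : X × X, ε ≤ dist p.1 p.2 → Ψ p = 0

namespace IsTransitionDensity

variable {Ψ : X × X → ℝ}

theorem ae_integrable (hΨ : IsTransitionDensity ε Ψ) : ∀ᵐ x, Integrable fun y => Ψ (x, y) := by
  filter_upwards [hΨ.integral_eq_one] with x hx
  -- The Bochner integral of a non-integrable function is `0`, not `1`.
  by_contra h
  rw [integral_undef h] at hx
  exact zero_ne_one hx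

/-- Tonelli: since the slices have mass one, the absolute value integrates over `y` to `|ρ x|`. -/
theorem integrable_mul (hΨ : IsTransitionDensity ε Ψ) {ρ : X → ℝ} (hρ : Integrable ρ) :
    Integrable fun p : X × X => Ψ p * ρ p.1 := by
  rw [Measure.volume_eq_prod, integrable_prod_iff]
  · constructor
    · filter_upwards [hΨ.ae_integrable] with x hx using hx.mul_const _
    · refine hρ.norm.congr ?_
      filter_upwards [hΨ.integral_eq_one, Measure.ae_ae_of_ae_prod hΨ.nonneg] with x hx hx0
      have : ∀ᵐ y, ‖Ψ (x, y) * ρ x‖ = Ψ (x, y) * ‖ρ x‖ := by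
        filter_upwards [hx0] with y hy
        rw [norm_mul, Real.norm_of_nonneg hy]
      rw [integral_congr_ae this, integral_mul_const, hx, one_mul]
  · exact hΨ.measurable.aestronglyMeasurable.mul (hρ.aestronglyMeasurable.comp_fst)

end IsTransitionDensity

theorem ae_abs_sub_div_le (hε : 0 < ε) (hu : ∀ᵐ x, |u x| ≤ M) :
    ∀ᵐ p : X × X, ‖(u p.2 - u p.1) / ε‖ ≤ (M + M) / ε := by
  rw [Measure.volume_eq_prod]
  filter_upwards [Measure.quasiMeasurePreserving_fst.ae hu,
    Measure.quasiMeasurePreserving_snd.ae hu] with p h1 h2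
  rw [Real.norm_eq_abs, abs_div, abs_of_pos hε]
  gcongr
  exact (abs_sub _ _).trans (add_le_add h2 h1)

theorem integrable_sub_div_mul (hε : 0 < ε) (hum : Measurable u) (hu : ∀ᵐ x, |u x| ≤ M)
    {f : X × X → ℝ} (hf : Integrable f) :
    Integrable fun p : X × X => (u p.2 - u p.1) / ε * f p :=
  hf.bdd_mul (((hum.comp measurable_snd).sub
    (hum.comp measurable_fst)).div_const ε).aestronglyMeasurable (ae_abs_sub_div_le hε hu)

theorem integrable_sub_mul_of_ae_abs_le (hum : Measurable u) (hu : ∀ᵐ x, |u x| ≤ M) (c : ℝ)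
    {g : X → ℝ} (hg : Integrable g) : Integrable fun y => (u y - c) * g y := by
  refine hg.bdd_mul (c := M + |c|) (hum.sub_const c).aestronglyMeasurable ?_
  filter_upwards [hu] with y hy
  exact (abs_sub _ _).trans (add_le_add_left hy _)

theorem IsTransitionDensity.integral_sub_div_mul_le [(volume : Measure X).IsOpenPosMeasure]
    {Ψ : X × X → ℝ} (hΨ : IsTransitionDensity ε Ψ) (hε : 0 < ε) (hum : Measurable u)
    (hu : ∀ᵐ x, |u x| ≤ M) {ρ : X → ℝ} (hρ : Integrable ρ) (hρ0 : ∀ x, 0 ≤ ρ x) :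
    ∫ x, ∫ y, (u y - u x) / ε * (Ψ (x, y) * ρ x) ≤
      ∫ x, (essSup u (volume.restrict (ball x ε)) - u x) / ε * ρ x := by
  refine integral_mono_ae
    (integrable_sub_div_mul hε hum hu (hΨ.integrable_mul hρ)).integral_prod_left
    (integrable_essSup_sub_div_mul hε hum hu hρ) ?_
  filter_upwards [hΨ.integral_eq_one, hΨ.ae_integrable, Measure.ae_ae_of_ae_prod hΨ.nonneg,
    Measure.ae_ae_of_ae_prod hΨ.eq_zero] with x h1 hi h0 hz
  have hS := (ae_restrict_iff' measurableSet_ball).1 (ae_le_essSup_of_ae_abs_le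
      (ae_restrict_of_ae (s := ball x ε) hu))
  set S := essSup u (volume.restrict (ball x ε))
  have key : ∫ y, (u y - u x) * Ψ (x, y) ≤ S - u x := by
    calc ∫ y, (u y - u x) * Ψ (x, y) ≤ ∫ y, (S - u x) * Ψ (x, y) := by
          refine integral_mono_ae (integrable_sub_mul_of_ae_abs_le hum hu _ hi)
            (hi.const_mul _) ?_
          filter_upwards [h0, hz, hS] with y hy0 hyz hyS
          by_cases hd : ε ≤ dist x y
          · simp only [hyz hd, mul_zero, le_refl]
          · have := hyS (mem_ball'.2 (not_le.1 hd))
            gcongr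
      _ = S - u x := by rw [integral_const_mul, h1, mul_one]
  calc ∫ y, (u y - u x) / ε * (Ψ (x, y) * ρ x)
      = (∫ y, (u y - u x) * Ψ (x, y)) * (ρ x / ε) := by
        rw [← integral_mul_const]
        exact integral_congr_ae (Filter.Eventually.of_forall fun y => by ring)
    _ ≤ (S - u x) * (ρ x / ε) := by
        gcongr
        exact div_nonneg (hρ0 x) hε.le
    _ = (S - u x) / ε * ρ x := by ring

/-- The pairs `(x, y)` with `dist x y < ε` at which `u y` exceeds the essential supremum of `u`
over `ball x ε` up to `δ`. -/
def nearMaximizers (ε δ : ℝ) (u : X → ℝ) : Set (X × X) :=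
  {p | dist p.1 p.2 < ε ∧ essSup u (volume.restrict (ball p.1 ε)) - δ < u p.2}

/-- The transition density that is uniform on the near-maximizers of `u` in each ball. -/
noncomputable def nearMaximizerDensity (ε δ : ℝ) (u : X → ℝ) (p : X × X) : ℝ :=
  (nearMaximizers ε δ u).indicator
    (fun p => (volume (Prod.mk p.1 ⁻¹' nearMaximizers ε δ u)).toReal⁻¹) p

/-! ### Near-optimal transition densities. -/

section NearMaximizers

variable [(volume : Measure X).IsOpenPosMeasure]

theorem measurableSet_nearMaximizers (hε : 0 < ε) (hum : Measurable u) (hu : ∀ᵐ x, |u x| ≤ M)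
    (δ : ℝ) : MeasurableSet (nearMaximizers ε δ u) :=
  (measurableSet_lt (measurable_fst.dist measurable_snd) measurable_const).inter
    (measurableSet_lt
      (((lowerSemicontinuous_essSup_ball hε hum hu).measurable.comp measurable_fst).sub_const δ)
      (hum.comp measurable_snd))

theorem measure_nearMaximizers_pos (hε : 0 < ε) (hum : Measurable u) (hu : ∀ᵐ x, |u x| ≤ M)
    {δ : ℝ} (hδ : 0 < δ) (x : X) : 0 < volume (Prod.mk x ⁻¹' nearMaximizers ε δ u) := by
  have := neZero_restrict_ball hε x
  have hpos := measure_lt_pos_of_lt_essSup (ae_restrict_of_ae (s := ball x ε) hu)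
    (sub_lt_self _ hδ)
  rw [Measure.restrict_apply (measurableSet_lt measurable_const hum)] at hpos
  refine hpos.trans_le (measure_mono ?_)
  rintro y ⟨hy, hyx⟩
  exact ⟨mem_ball'.1 hyx, hy⟩

theorem nearMaximizerDensity_nonneg (δ : ℝ) (p : X × X) : 0 ≤ nearMaximizerDensity ε δ u p :=
  indicator_nonneg (fun _ _ => inv_nonneg.2 ENNReal.toReal_nonneg) _

theorem isTransitionDensity_nearMaximizerDensity (hε : 0 < ε) (hum : Measurable u)
    (hu : ∀ᵐ x, |u x| ≤ M) {δ : ℝ} (hδ : 0 < δ) :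
    IsTransitionDensity ε (nearMaximizerDensity ε δ u) where
  measurable :=
    ((measurable_measure_prodMk_left
      (measurableSet_nearMaximizers hε hum hu δ)).ennreal_toReal.inv.comp measurable_fst).indicator
      (measurableSet_nearMaximizers hε hum hu δ)
  nonneg := Filter.Eventually.of_forall (nearMaximizerDensity_nonneg δ)
  integral_eq_one := by
    refine Filter.Eventually.of_forall fun x => ?_
    have hm := measurable_prodMk_left (x := x) (measurableSet_nearMaximizers hε hum hu δ)
    have heq : (fun y => nearMaximizerDensity ε δ u (x, y)) =
        (Prod.mk x ⁻¹' nearMaximizers ε δ u).indicator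
          fun _ => (volume (Prod.mk x ⁻¹' nearMaximizers ε δ u)).toReal⁻¹ := by
      ext y
      simp only [nearMaximizerDensity, indicator]
      rfl
    rw [heq, integral_indicator_const _ hm, smul_eq_mul, Measure.real]
    exact mul_inv_cancel₀ (ENNReal.toReal_pos
      (measure_nearMaximizers_pos hε hum hu hδ x).ne' (measure_ne_top _ _)).ne'
  eq_zero := Filter.Eventually.of_forall fun p hp =>
    indicator_of_notMem (fun h => hp.not_gt h.1) _

theorem exists_le_integral_sub_div_mul (hε : 0 < ε) (hum : Measurable u)
    (hu : ∀ᵐ x, |u x| ≤ M) {ρ : X → ℝ} (hρ : Integrable ρ) (hρ0 : ∀ x, 0 ≤ ρ x)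
    {η : ℝ} (hη : 0 < η) :
    ∃ Ψ : X × X → ℝ, IsTransitionDensity ε Ψ ∧
      (∫ x, (essSup u (volume.restrict (ball x ε)) - u x) / ε * ρ x) - η ≤
        ∫ x, ∫ y, (u y - u x) / ε * (Ψ (x, y) * ρ x) := by
  have hI : 0 ≤ ∫ x, ρ x := integral_nonneg hρ0
  -- The total loss `δ / ε * ∫ ρ` is then at most `η`; the `+ 1` covers the case `∫ ρ = 0`.
  set δ : ℝ := η * ε / ((∫ x, ρ x) + 1) with hδdef
  have hδ : 0 < δ := by positivity
  have hΨ := isTransitionDensity_nearMaximizerDensity hε hum hu hδ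
  refine ⟨_, hΨ, ?_⟩
  have hS := integrable_essSup_sub_div_mul hε hum hu hρ
  have hδη : (∫ x, δ / ε * ρ x) ≤ η := by
    rw [integral_const_mul, hδdef]
    rw [mul_div_right_comm, mul_div_cancel_right₀ _ hε.ne', div_mul_eq_mul_div,
      div_le_iff₀ (by positivity)]
    nlinarith
  calc (∫ x, (essSup u (volume.restrict (ball x ε)) - u x) / ε * ρ x) - η
      ≤ ∫ x, ((essSup u (volume.restrict (ball x ε)) - u x) / ε * ρ x - δ / ε * ρ x) := by
        rw [integral_sub hS (hρ.const_mul _)]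
        linarith
    _ ≤ _ := by
        refine integral_mono_ae (hS.sub (hρ.const_mul _))
          (integrable_sub_div_mul hε hum hu (hΨ.integrable_mul hρ)).integral_prod_left ?_
        filter_upwards [hΨ.integral_eq_one, hΨ.ae_integrable] with x h1 hi
        set S := essSup u (volume.restrict (ball x ε)) with hSdef
        have key : S - δ - u x ≤ ∫ y, (u y - u x) * nearMaximizerDensity ε δ u (x, y) := by
          calc S - δ - u x = ∫ y, (S - δ - u x) * nearMaximizerDensity ε δ u (x, y) := by
                rw [integral_const_mul, h1, mul_one]
            _ ≤ _ := by
                refine integral_mono (hi.const_mul _)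
                  (integrable_sub_mul_of_ae_abs_le hum hu _ hi) fun y => ?_
                by_cases hy : (x, y) ∈ nearMaximizers ε δ u
                · have h2 : S - δ < u y := hy.2
                  exact mul_le_mul_of_nonneg_right (by linarith)
                    (nearMaximizerDensity_nonneg δ _)
                · have h0 : nearMaximizerDensity ε δ u (x, y) = 0 := indicator_of_notMem hy _
                  simp only [h0, mul_zero, le_refl]
        calc (S - u x) / ε * ρ x - δ / ε * ρ x = (S - δ - u x) * (ρ x / ε) := by ring
          _ ≤ (∫ y, (u y - u x) * nearMaximizerDensity ε δ u (x, y)) * (ρ x / ε) := by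
            gcongr
            exact div_nonneg (hρ0 x) hε.le
          _ = _ := by
            rw [← integral_mul_const]
            exact integral_congr_ae (Filter.Eventually.of_forall fun y => by ring)

end NearMaximizers

/-! ### Duality of nonlocal gradient and divergence. -/

theorem ae_setIntegral_ball_eq_integral {f : X × X → ℝ}
    (hf0 : ∀ᵐ p : X × X, ε ≤ dist p.1 p.2 → f p = 0) :
    ∀ᵐ y, ∫ x in ball y ε, (f (y, x) - f (x, y)) / ε = ∫ x, (f (y, x) - f (x, y)) / ε := by
  -- The divergence involves both `f (y, x)` and `f (x, y)`, so vanishing is needed along both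
  -- slices.
  have hsw : ∀ᵐ p : X × X, ε ≤ dist p.2 p.1 → f p.swap = 0 :=
    Measure.measurePreserving_swap.quasiMeasurePreserving.ae hf0
  filter_upwards [Measure.ae_ae_of_ae_prod hf0, Measure.ae_ae_of_ae_prod hsw] with y h1 h2
  refine setIntegral_eq_integral_of_ae_compl_eq_zero ?_
  filter_upwards [h1, h2] with x hx1 hx2 hx
  rw [mem_ball, not_lt] at hx
  have e1 : f (y, x) = 0 := hx1 (by rwa [dist_comm])
  have e2 : f (x, y) = 0 := hx2 hx
  rw [e1, e2, sub_zero, zero_div]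

theorem integrable_setIntegral_ball {f : X × X → ℝ} (hf : Integrable f)
    (hf0 : ∀ᵐ p : X × X, ε ≤ dist p.1 p.2 → f p = 0) :
    Integrable fun y => ∫ x in ball y ε, (f (y, x) - f (x, y)) / ε :=
  (((hf.sub hf.swap).div_const ε).integral_prod_left).congr
    ((ae_setIntegral_ball_eq_integral hf0).mono fun _ h => h.symm)

/-- Both sides become integrals over the product; swapping the variables turns `u x * f (y, x)` into
`u y * f (x, y)`. -/
theorem integral_sub_div_mul_eq_neg_integral_mul (hum : Measurable u)
    (hu : ∀ᵐ x, |u x| ≤ M) {f : X × X → ℝ} (hf : Integrable f)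
    (hf0 : ∀ᵐ p : X × X, ε ≤ dist p.1 p.2 → f p = 0) :
    ∫ x, ∫ y, (u y - u x) / ε * f (x, y) =
      -∫ y, u y * ∫ x in ball y ε, (f (y, x) - f (x, y)) / ε := by
  have hfst : ∀ᵐ p : X × X, ‖u p.1‖ ≤ M := Measure.quasiMeasurePreserving_fst.ae hu
  have hsnd : ∀ᵐ p : X × X, ‖u p.2‖ ≤ M := Measure.quasiMeasurePreserving_snd.ae hu
  have i1 : Integrable fun p : X × X => u p.1 * (f p / ε) :=
    (hf.div_const ε).bdd_mul (hum.comp measurable_fst).aestronglyMeasurable hfst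
  have i2 : Integrable fun p : X × X => u p.2 * (f p / ε) :=
    (hf.div_const ε).bdd_mul (hum.comp measurable_snd).aestronglyMeasurable hsnd
  have i3 : Integrable fun p : X × X => u p.1 * (f p.swap / ε) := i2.swap
  have e1 : ∫ y, u y * ∫ x in ball y ε, (f (y, x) - f (x, y)) / ε =
      ∫ p : X × X, (u p.1 * (f p / ε) - u p.1 * (f p.swap / ε)) := by
    rw [Measure.volume_eq_prod, integral_prod
      (fun p : X × X => u p.1 * (f p / ε) - u p.1 * (f p.swap / ε)) (i1.sub i3)]
    refine integral_congr_ae ?_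
    filter_upwards [ae_setIntegral_ball_eq_integral hf0] with y hy
    rw [hy, ← integral_const_mul]
    exact integral_congr_ae (Filter.Eventually.of_forall fun x => by
      simp only [Prod.swap_prod_mk]; ring)
  have e2 : ∫ x, ∫ y, (u y - u x) / ε * f (x, y) =
      ∫ p : X × X, (u p.2 * (f p / ε) - u p.1 * (f p / ε)) := by
    rw [Measure.volume_eq_prod, integral_prod
      (fun p : X × X => u p.2 * (f p / ε) - u p.1 * (f p / ε)) (i2.sub i1)]
    exact integral_congr_ae (Filter.Eventually.of_forall fun x =>
      integral_congr_ae (Filter.Eventually.of_forall fun y => by ring))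
  have e3 : ∫ p : X × X, u p.1 * (f p.swap / ε) = ∫ p : X × X, u p.2 * (f p / ε) :=
    integral_prod_swap (μ := volume) (ν := volume) fun p : X × X => u p.2 * (f p / ε)
  rw [e1, e2, integral_sub i1 i3, integral_sub i2 i1, e3]
  ring

end MetricMeasure

section Congr

variable {X : Type*} [MetricSpace X] [MeasureSpace X] [SFinite (volume : Measure X)] {ε : ℝ}

/-- Allows passing from an explicit density to the representative chosen for its `L¹` class. -/
theorem IsTransitionDensity.congr {Ψ Φ : X × X → ℝ} (hΨ : IsTransitionDensity ε Ψ)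
    (hΦ : Measurable Φ) (h : Φ =ᵐ[volume] Ψ) : IsTransitionDensity ε Φ where
  measurable := hΦ
  nonneg := by filter_upwards [hΨ.nonneg, h] with p hp hp' using hp'.symm ▸ hp
  integral_eq_one := by
    filter_upwards [hΨ.integral_eq_one, Measure.ae_ae_of_ae_prod h] with x hx hx'
    rw [← hx]
    exact integral_congr_ae hx'
  eq_zero := by filter_upwards [hΨ.eq_zero, h] with p hp hp' hd using hp'.trans (hp hd)

end Congr

/-! ### Back to the domain `Ω` and the test densities. -/

section Domain

variable {N : ℕ} {Ω : Set (EuclideanSpace ℝ (Fin N))} {ε : ℝ}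

theorem isFiniteMeasure_volume_subtype (hΩb : Bornology.IsBounded Ω) (hΩ : MeasurableSet Ω) :
    IsFiniteMeasure (volume : Measure Ω) := by
  refine ⟨?_⟩
  rw [Measure.Subtype.volume_def,
    (MeasurableEmbedding.subtype_coe hΩ).comap_apply, image_univ, Subtype.range_coe]
  exact hΩb.measure_lt_top

theorem isOpenPosMeasure_volume_subtype (hΩo : IsOpen Ω) :
    (volume : Measure Ω).IsOpenPosMeasure := by
  refine ⟨fun U hU hne => ?_⟩
  rw [Measure.Subtype.volume_def,
    (MeasurableEmbedding.subtype_coe hΩo.measurableSet).comap_apply]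
  exact (hΩo.isOpenMap_subtype_val U hU).measure_ne_zero volume (hne.image _)

theorem volume_sphere_subtype (hΩ : MeasurableSet Ω) (hε : 0 < ε) (x : Ω) :
    volume (sphere x ε) = 0 := by
  rw [Measure.Subtype.volume_def, (MeasurableEmbedding.subtype_coe hΩ).comap_apply]
  refine measure_mono_null ?_ (Measure.addHaar_sphere_of_ne_zero volume (x : EuclideanSpace ℝ (Fin N))
    hε.ne')
  rintro _ ⟨y, hy, rfl⟩
  exact hy

/-- Forward, the bad set is locally null, hence null. Conversely, the complements of the closed ball
and of `closure Ω` serve as neighbourhoods, the latter containing no point of `Ω`. -/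
theorem essSupport_subset_iff (φ : Ω → ℝ) (x : Ω) :
    essSupport φ ⊆ closedBall (x : EuclideanSpace ℝ (Fin N)) ε ∩ closure Ω ↔
      ∀ᵐ y : Ω, ε < dist x y → φ y = 0 := by
  constructor
  · intro h
    rw [ae_iff]
    refine measure_null_of_locally_null _ fun y hy => ?_
    have hyd : ε < dist x y := by
      by_contra hcon
      exact hy fun h' => absurd h' hcon
    have hns : (y : EuclideanSpace ℝ (Fin N)) ∉ essSupport φ := fun hmem =>
      hyd.not_ge (mem_closedBall'.1 (h hmem).1)
    obtain ⟨U, hU, hU0⟩ : ∃ U ∈ 𝓝 (y : EuclideanSpace ℝ (Fin N)),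
        ∀ᵐ z : Ω, (z : EuclideanSpace ℝ (Fin N)) ∈ U → φ z = 0 := by
      by_contra hcon
      exact hns fun U hU hU0 => hcon ⟨U, hU, hU0⟩
    refine ⟨Subtype.val ⁻¹' U ∩ {z | ¬(ε < dist x z → φ z = 0)},
      ?_, ?_⟩
    · rw [inter_comm]
      exact inter_mem_nhdsWithin _ (continuous_subtype_val.continuousAt.preimage_mem_nhds hU)
    refine measure_mono_null ?_ (ae_iff.1 hU0)
    rintro z ⟨hzU, hz⟩ hcon
    exact hz fun _ => hcon hzU
  · intro h z hz
    by_contra hcon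
    rw [mem_inter_iff, not_and_or] at hcon
    rcases hcon with hcon | hcon
    · refine hz _ (isClosed_closedBall.isOpen_compl.mem_nhds hcon) ?_
      filter_upwards [h] with y hy hyU
      exact hy (not_le.1 fun hle => hyU (mem_closedBall'.2 hle))
    · refine hz _ (isClosed_closure.isOpen_compl.mem_nhds hcon) ?_
      exact Filter.Eventually.of_forall fun y hy => absurd (subset_closure y.2) hy

/-- The strict and weak inequalities differ only on spheres, which are null; measurability of `Ψ`
lets slicewise a.e. statements pass to the product. -/
theorem ae_eq_zero_of_le_dist_iff [SFinite (volume : Measure Ω)] (hΩ : MeasurableSet Ω)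
    (hε : 0 < ε) {Ψ : Ω × Ω → ℝ} (hΨ : Measurable Ψ) :
    (∀ᵐ x : Ω, ∀ᵐ y : Ω, ε < dist x y → Ψ (x, y) = 0) ↔
      ∀ᵐ p : Ω × Ω, ε ≤ dist p.1 p.2 → Ψ p = 0 := by
  have hm : MeasurableSet {p : Ω × Ω | ε ≤ dist p.1 p.2 → Ψ p = 0} := by
    have : {p : Ω × Ω | ε ≤ dist p.1 p.2 → Ψ p = 0} =
        {p : Ω × Ω | ε ≤ dist p.1 p.2}ᶜ ∪ {p | Ψ p = 0} := by
      ext p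
      exact imp_iff_not_or
    rw [this]
    exact (measurableSet_le measurable_const (measurable_fst.dist measurable_snd)).compl.union
      (hΨ (measurableSet_singleton 0))
  rw [Measure.volume_eq_prod, Measure.ae_prod_iff_ae_ae hm]
  refine Filter.eventually_congr (Filter.Eventually.of_forall fun x => ?_)
  have hs : ∀ᵐ y : Ω, y ∉ sphere x ε :=
    measure_eq_zero_iff_ae_notMem.1 (volume_sphere_subtype hΩ hε x)
  refine Filter.eventually_congr (hs.mono fun y hy => ?_)
  rw [mem_sphere'] at hy
  exact ⟨fun h hle => h (lt_of_le_of_ne hle (Ne.symm hy)), fun h hlt => h hlt.le⟩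

theorem mem_testDensities_iff [SFinite (volume : Measure Ω)] (hΩ : MeasurableSet Ω) (hε : 0 < ε)
    (Ψ : Lp ℝ 1 (volume : Measure (Ω × Ω))) :
    Ψ ∈ testDensities Ω ε ↔ IsTransitionDensity ε Ψ := by
  have hm : Measurable Ψ := (Lp.stronglyMeasurable Ψ).measurable
  have hiff : (∀ᵐ x : Ω, essSupport (fun y : Ω => Ψ (x, y)) ⊆
      closedBall (x : EuclideanSpace ℝ (Fin N)) ε ∩ closure Ω) ↔
      ∀ᵐ p : Ω × Ω, ε ≤ dist p.1 p.2 → Ψ p = 0 := by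
    simp_rw [essSupport_subset_iff]
    exact ae_eq_zero_of_le_dist_iff hΩ hε hm
  exact ⟨fun h => ⟨hm, h.1, h.2.1, hiff.1 h.2.2⟩,
    fun h => ⟨h.nonneg, h.integral_eq_one, hiff.2 h.eq_zero⟩⟩

theorem IsTransitionDensity.exists_mem_testDensities [IsFiniteMeasure (volume : Measure Ω)]
    (hΩ : MeasurableSet Ω) (hε : 0 < ε) {Ψ : Ω × Ω → ℝ} (hΨ : IsTransitionDensity ε Ψ) :
    ∃ Φ ∈ testDensities Ω ε, Φ =ᵐ[volume] Ψ := by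
  have hi : Integrable Ψ := by
    simpa only [mul_one] using hΨ.integrable_mul (integrable_const (1 : ℝ))
  have hae : hi.toL1 =ᵐ[volume] Ψ := hi.coeFn_toL1
  exact ⟨hi.toL1, (mem_testDensities_iff hΩ hε _).2
    (hΨ.congr (Lp.stronglyMeasurable _).measurable hae), hae⟩

variable {Ψ₀ Ψ₁ : Ω × Ω → ℝ} {ρ₀ ρ₁ : Ω → ℝ} {u : Ω → ℝ} {M : ℝ}

theorem integrable_pairing [IsFiniteMeasure (volume : Measure Ω)]
    (h₀ : IsTransitionDensity ε Ψ₀) (h₁ : IsTransitionDensity ε Ψ₁)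
    (hρ₀ : Integrable ρ₀) (hρ₁ : Integrable ρ₁) : Integrable (pairing Ψ₀ Ψ₁ ρ₀ ρ₁) :=
  (h₀.integrable_mul hρ₀).sub (h₁.integrable_mul hρ₁)

theorem pairing_ae_eq_zero (h₀ : IsTransitionDensity ε Ψ₀) (h₁ : IsTransitionDensity ε Ψ₁) :
    ∀ᵐ p : Ω × Ω, ε ≤ dist p.1 p.2 → pairing Ψ₀ Ψ₁ ρ₀ ρ₁ p = 0 := by
  filter_upwards [h₀.eq_zero, h₁.eq_zero] with p hp₀ hp₁ hp
  rw [pairing, hp₀ hp, hp₁ hp, zero_mul, zero_mul, sub_zero]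

theorem integral_nonlocalGrad_mul_pairing [IsFiniteMeasure (volume : Measure Ω)] (hε : 0 < ε)
    (hum : Measurable u) (hu : ∀ᵐ x, |u x| ≤ M)
    (h₀ : IsTransitionDensity ε Ψ₀) (h₁ : IsTransitionDensity ε Ψ₁)
    (hρ₀ : Integrable ρ₀) (hρ₁ : Integrable ρ₁) :
    ∫ x : Ω, ∫ y : Ω, nonlocalGrad ε u (x, y) * pairing Ψ₀ Ψ₁ ρ₀ ρ₁ (x, y) =
      (∫ x : Ω, ∫ y : Ω, (u y - u x) / ε * (Ψ₀ (x, y) * ρ₀ x)) +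
        ∫ x : Ω, ∫ y : Ω, (-u y - -u x) / ε * (Ψ₁ (x, y) * ρ₁ x) := by
  have i₀ := integrable_sub_div_mul hε hum hu (h₀.integrable_mul hρ₀)
  have i₁ := integrable_sub_div_mul hε hum.neg (u := fun x => -u x) (M := M)
    (by simpa only [abs_neg] using hu) (h₁.integrable_mul hρ₁)
  rw [← integral_add i₀.integral_prod_left i₁.integral_prod_left]
  refine integral_congr_ae ?_
  filter_upwards [i₀.prod_right_ae, i₁.prod_right_ae] with x hx₀ hx₁
  rw [← integral_add hx₀ hx₁]
  refine integral_congr_ae (Filter.Eventually.of_forall fun y => ?_)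
  simp only [nonlocalGrad, pairing]
  ring

theorem integral_integral_congr_density [IsFiniteMeasure (volume : Measure Ω)]
    {Φ Ψ : Ω × Ω → ℝ} (h : Φ =ᵐ[volume] Ψ) (g : Ω → Ω → ℝ) (ρ : Ω → ℝ) :
    ∫ x, ∫ y, g x y * (Φ (x, y) * ρ x) = ∫ x, ∫ y, g x y * (Ψ (x, y) * ρ x) := by
  refine integral_congr_ae ?_
  filter_upwards [Measure.ae_ae_of_ae_prod h] with x hx
  refine integral_congr_ae ?_
  filter_upwards [hx] with y hy
  rw [hy]

theorem lowerIntegrand_eq_upperIntegrand_neg (ε : ℝ) (ρ u : Ω → ℝ) :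
    lowerIntegrand ε ρ u = upperIntegrand ε ρ fun x => -u x := by
  ext x
  rw [lowerIntegrand, upperIntegrand, essInf_eq_neg_essSup_neg]
  ring

theorem isLUB_integral_nonlocalGrad_mul_pairing [IsFiniteMeasure (volume : Measure Ω)]
    [(volume : Measure Ω).IsOpenPosMeasure] (hΩ : MeasurableSet Ω) (hε : 0 < ε)
    (hum : Measurable u) (hu : ∀ᵐ x, |u x| ≤ M)
    (hρ₀ : Integrable ρ₀) (hρ₁ : Integrable ρ₁) (h0ρ₀ : ∀ x, 0 ≤ ρ₀ x) (h0ρ₁ : ∀ x, 0 ≤ ρ₁ x) :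
    IsLUB {r : ℝ | ∃ Ψ₀ ∈ testDensities Ω ε, ∃ Ψ₁ ∈ testDensities Ω ε,
        r = ∫ x : Ω, ∫ y : Ω, nonlocalGrad ε u (x, y) * pairing Ψ₀ Ψ₁ ρ₀ ρ₁ (x, y)}
      (adversarialTV ε ρ₀ ρ₁ u) := by
  have hun : ∀ᵐ x, |-u x| ≤ M := by simpa only [abs_neg] using hu
  rw [adversarialTV, lowerIntegrand_eq_upperIntegrand_neg]
  constructor
  · rintro r ⟨Ψ₀, h₀, Ψ₁, h₁, rfl⟩
    rw [mem_testDensities_iff hΩ hε] at h₀ h₁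
    rw [integral_nonlocalGrad_mul_pairing hε hum hu h₀ h₁ hρ₀ hρ₁]
    exact add_le_add (h₀.integral_sub_div_mul_le hε hum hu hρ₀ h0ρ₀)
      (h₁.integral_sub_div_mul_le hε hum.neg hun hρ₁ h0ρ₁)
  · intro b hb
    refine le_of_forall_pos_le_add fun η hη => ?_
    -- `Ψ₀` and `Ψ₁` are chosen independently, each with error `η / 2`.
    obtain ⟨Φ₀, hΦ₀, hle₀⟩ := exists_le_integral_sub_div_mul hε hum hu hρ₀ h0ρ₀ (half_pos hη)
    obtain ⟨Φ₁, hΦ₁, hle₁⟩ :=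
      exists_le_integral_sub_div_mul (u := fun x => -u x) hε hum.neg hun hρ₁ h0ρ₁ (half_pos hη)
    obtain ⟨Ψ₀, h₀, hae₀⟩ := hΦ₀.exists_mem_testDensities hΩ hε
    obtain ⟨Ψ₁, h₁, hae₁⟩ := hΦ₁.exists_mem_testDensities hΩ hε
    have hle := hb ⟨Ψ₀, h₀, Ψ₁, h₁, rfl⟩
    rw [mem_testDensities_iff hΩ hε] at h₀ h₁
    rw [integral_nonlocalGrad_mul_pairing hε hum hu h₀ h₁ hρ₀ hρ₁,
      integral_integral_congr_density hae₀ fun x y => (u y - u x) / ε,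
      integral_integral_congr_density hae₁ fun x y => (-u y - -u x) / ε] at hle
    simp only [upperIntegrand]
    linarith

theorem integrable_density (μ : Measure (Ω × Fin 2)) [IsFiniteMeasure μ] (i : Fin 2) :
    Integrable (density μ i) := by
  have : IsFiniteMeasure (classMeasure μ i) := by
    unfold classMeasure
    infer_instance
  exact Measure.integrable_toReal_rnDeriv

theorem density_nonneg (μ : Measure (Ω × Fin 2)) (i : Fin 2) (x : Ω) : 0 ≤ density μ i x :=
  ENNReal.toReal_nonneg

end Domain

theorem ae_abs_le_of_Lp_top {X : Type*} [MeasurableSpace X] {ν : Measure X} (u : Lp ℝ ∞ ν) :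
    ∀ᵐ x ∂ν, |u x| ≤ ‖u‖ := by
  filter_upwards [ae_le_eLpNormEssSup (f := u) (μ := ν)] with x hx
  rw [← eLpNorm_exponent_top] at hx
  rw [Lp.norm_def, ← Real.norm_eq_abs, ← toReal_enorm]
  exact ENNReal.toReal_mono (Lp.eLpNorm_ne_top u) hx

end AdversarialTV

theorem mainTheorem4 {N : ℕ} (Ω : Set (EuclideanSpace ℝ (Fin N)))
    (hΩo : IsOpen Ω) (hΩb : Bornology.IsBounded Ω) (hΩc : Convex ℝ Ω)
    (ε : ℝ) (hε : 0 < ε)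
    (μ : Measure (Ω × Fin 2)) [IsProbabilityMeasure μ]
    (hρ : ∀ i : Fin 2, AdversarialTV.classMeasure μ i ≪ (volume : Measure Ω))
    (ρ₀ ρ₁ : Ω → ℝ)
    (hρ₀ : ρ₀ = AdversarialTV.density μ 0) (hρ₁ : ρ₁ = AdversarialTV.density μ 1)
    (u : Lp ℝ ∞ (volume : Measure Ω)) :
    -- all integrals below exist, and the nonlocal divergence is in `L¹(Ω)`
    (Integrable (AdversarialTV.upperIntegrand ε ρ₀ u) ∧
      Integrable (AdversarialTV.lowerIntegrand ε ρ₁ u)) ∧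
    (∀ Ψ₀ ∈ AdversarialTV.testDensities Ω ε, ∀ Ψ₁ ∈ AdversarialTV.testDensities Ω ε,
      Integrable (AdversarialTV.pairing Ψ₀ Ψ₁ ρ₀ ρ₁) ∧
      Integrable (fun p : Ω × Ω =>
        AdversarialTV.nonlocalGrad ε u p * AdversarialTV.pairing Ψ₀ Ψ₁ ρ₀ ρ₁ p) ∧
      Integrable (AdversarialTV.nonlocalDiv ε (AdversarialTV.pairing Ψ₀ Ψ₁ ρ₀ ρ₁)) ∧
      Integrable (fun y : Ω =>
        u y * AdversarialTV.nonlocalDiv ε (AdversarialTV.pairing Ψ₀ Ψ₁ ρ₀ ρ₁) y)) ∧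
    -- the first representation
    IsLUB {r : ℝ | ∃ Ψ₀ ∈ AdversarialTV.testDensities Ω ε,
        ∃ Ψ₁ ∈ AdversarialTV.testDensities Ω ε,
        r = ∫ x : Ω, ∫ y : Ω, AdversarialTV.nonlocalGrad ε u (x, y) *
          AdversarialTV.pairing Ψ₀ Ψ₁ ρ₀ ρ₁ (x, y)}
      (AdversarialTV.adversarialTV ε ρ₀ ρ₁ u) ∧
    -- the second representation
    IsLUB {r : ℝ | ∃ Ψ₀ ∈ AdversarialTV.testDensities Ω ε,
        ∃ Ψ₁ ∈ AdversarialTV.testDensities Ω ε,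
        r = -∫ y : Ω, u y *
          AdversarialTV.nonlocalDiv ε (AdversarialTV.pairing Ψ₀ Ψ₁ ρ₀ ρ₁) y}
      (AdversarialTV.adversarialTV ε ρ₀ ρ₁ u) := by
  open AdversarialTV in
  have hΩ := hΩo.measurableSet
  have := isFiniteMeasure_volume_subtype hΩb hΩ
  have := isOpenPosMeasure_volume_subtype hΩo
  have hum : Measurable u := (Lp.stronglyMeasurable u).measurable
  have hu := ae_abs_le_of_Lp_top u
  have hun : ∀ᵐ x, |-u x| ≤ ‖u‖ := by simpa only [abs_neg] using hu
  have hi₀ : Integrable ρ₀ := hρ₀ ▸ integrable_density μ 0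
  have hi₁ : Integrable ρ₁ := hρ₁ ▸ integrable_density μ 1
  have hn₀ : ∀ x, 0 ≤ ρ₀ x := hρ₀ ▸ density_nonneg μ 0
  have hn₁ : ∀ x, 0 ≤ ρ₁ x := hρ₁ ▸ density_nonneg μ 1
  have hlub := isLUB_integral_nonlocalGrad_mul_pairing hΩ hε hum hu hi₀ hi₁ hn₀ hn₁
  refine ⟨⟨integrable_essSup_sub_div_mul hε hum hu hi₀, ?_⟩, fun Ψ₀ h₀ Ψ₁ h₁ => ?_, hlub, ?_⟩
  · rw [lowerIntegrand_eq_upperIntegrand_neg]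
    exact integrable_essSup_sub_div_mul hε hum.neg hun hi₁
  · rw [mem_testDensities_iff hΩ hε] at h₀ h₁
    have hp := integrable_pairing h₀ h₁ hi₀ hi₁
    have hd := integrable_setIntegral_ball hp (pairing_ae_eq_zero h₀ h₁)
    exact ⟨hp, integrable_sub_div_mul hε hum hu hp, hd,
      hd.bdd_mul hum.aestronglyMeasurable hu⟩
  -- The duality identity holds for each pair of test densities, so the two sets of values coincide.
  · convert hlub using 1
    ext r
    refine exists_congr fun Ψ₀ => and_congr_right fun h₀ => exists_congr fun Ψ₁ =>
      and_congr_right fun h₁ => ?_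
    rw [mem_testDensities_iff hΩ hε] at h₀ h₁
    exact (integral_sub_div_mul_eq_neg_integral_mul hum hu (integrable_pairing h₀ h₁ hi₀ hi₁)
      (pairing_ae_eq_zero h₀ h₁)) ▸ Iff.rfl
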